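/- Let $p$ be an odd prime, let $m\ge 5$ be odd, let $\mathrm{Tr}$ be the trace from $\mathrm{GF}(p^m)$ to $\mathrm{GF}(p)$, and let $D=\{x\in \mathrm{GF}(p^m)^*: \mathrm{Tr}(x^2)=0\}$. Let $\bar D=\{d_0,\dots,d_{n-1}\}\subseteq \mathrm{GF}(p^m)$ (with $d_0,\dots,d_{n-1}$ distinct) be any set such that $D=\{ab: a\in \mathrm{GF}(p)^*,\ b\in\bar D\}$ and $d_i/d_j\notin \mathrm{GF}(p)^*$ for all $i\ne j$, and let $$\mathcal C_{\bar D}=\{(\mathrm{Tr}(xd_0),\dots,\mathrm{Tr}(xd_{n-1})): x\in \mathrm{GF}(p^m)\}\subseteq \mathrm{GF}(p)^n .$$ Let $H=[\mathbf h_0,\dots,\mathbf h_{n-1}]$ be any generator matrix (a matrix whose rows form a basis) of the dual code $\mathcal C_{\bar D}^{\perp}$. In the secret sharing scheme based on $\mathcal C_{\bar D}^\perp$ the participants are $P_1,\dots,P_{n-1}$; the dealer chooses a vector $\mathbf u$ over $\mathrm{GF}(p)$, the secret is $\mathbf u\mathbf h_0$, and the share of $P_i$ is $\mathbf u\mathbf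 h_i$. An access set is a set of participants whose shares determine the secret; it is minimal if no proper subset of it is an access set. A codeword is minimal if it is nonzero and its support does not properly contain the support of another nonzero codeword. Then: 1. every nonzero codeword of $\mathcal C_{\bar D}$ is minimal; 2. the number of participants is $n-1=\frac{p^{m-1}-1}{p-1}-1$; 3. the number of minimal access sets is exactly $p^{m-1}$; 4. every participant is a member of exactly $(p-1)p^{m-2}$ minimal access sets; in particular the scheme is democratic, i.e. all participants belong to the same number of minimal access sets. -/

import Mathlib

namespace SecretSharing

/-! ### Linear codes over a field `K`: subspaces of `K ^ n` -/

section Codes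

variable {K : Type*} [Field K] {n k : ℕ}

/-- The dual code: all vectors whose inner product with every codeword vanishes. -/
def dualCode (C : Submodule K (Fin n → K)) : Submodule K (Fin n → K) where
  carrier := {y | ∀ x ∈ C, x ⬝ᵥ y = 0}
  zero_mem' := fun x _ => dotProduct_zero x
  add_mem' := fun {a b} ha hb x hx => by rw [dotProduct_add, ha x hx, hb x hx, add_zero]
  smul_mem' := fun c a ha x hx => by rw [dotProduct_smul, ha x hx, smul_zero]

/-- `G` is a generator matrix of `C`: its rows form a basis of `C`. -/
def IsGeneratorMatrix (G : Matrix (Fin k) (Fin n) K) (C : Submodule K (Fin n → K)) : Prop :=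
  LinearIndependent K G.row ∧ Submodule.span K (Set.range G.row) = C

/-- `x` covers `y` if the support of `x` contains that of `y` as a proper subset. -/
def Covers (x y : Fin n → K) : Prop :=
  Function.support y ⊂ Function.support x

/-- A minimal codeword: a nonzero codeword covering no other nonzero codeword. -/
def IsMinimalCodeword (C : Submodule K (Fin n → K)) (c : Fin n → K) : Prop :=
  c ∈ C ∧ c ≠ 0 ∧ ∀ c' ∈ C, c' ≠ 0 → c' ≠ c → ¬ Covers c c'

end Codes

/-! ### Secret sharing schemes -/

/-- A secret sharing scheme with secret space `S`, participants `P` and share spaces `Sh i`. The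
dealer picks an element of `R` (the dealer's choice); it determines the secret and all shares. -/
structure SecretSharingScheme (R S P : Type*) (Sh : P → Type*) where
  /-- the secret belonging to a choice of the dealer -/
  secret : R → S
  /-- the share handed to each participant -/
  share : R → (i : P) → Sh i

namespace SecretSharingScheme

variable {R S P : Type*} {Sh : P → Type*} (σ : SecretSharingScheme R S P Sh)

/-- The number of participants. -/
noncomputable def numParticipants (_σ : SecretSharingScheme R S P Sh) : ℕ := Nat.card P

/-- `A` is an access set: the shares of the members of `A` determine the secret. -/
def IsAccessSet (A : Finset P) : Prop :=
  ∀ u v : R, (∀ i ∈ A, σ.share u i = σ.share v i) → σ.secret u = σ.secret v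

/-- A minimal access set: an access set none of whose proper subsets is an access set. -/
def IsMinimalAccessSet (A : Finset P) : Prop :=
  σ.IsAccessSet A ∧ ∀ B : Finset P, B ⊂ A → ¬ σ.IsAccessSet B

/-- The set of all minimal access sets. -/
def minimalAccessSets : Set (Finset P) := {A | σ.IsMinimalAccessSet A}

/-- The set of all minimal access sets to which participant `i` belongs. -/
def minimalAccessSetsOf (i : P) : Set (Finset P) := {A | σ.IsMinimalAccessSet A ∧ i ∈ A}

/-- The scheme is democratic: all participants lie in the same number of minimal access sets. -/
def IsDemocratic : Prop :=
  ∀ i j : P, (σ.minimalAccessSetsOf i).ncard = (σ.minimalAccessSetsOf j).ncard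

end SecretSharingScheme

/-- The scheme of a code of length `ℓ + 1` with generator matrix `H = [h₀, h₁, …, h_ℓ]`: the dealer
picks a vector `u`, computes the codeword `t = u H`, keeps the secret `t₀ = u h₀` and gives
`t_i = u h_i` to participant `P_i`, for `1 ≤ i ≤ ℓ`. Participant `P_i` has index `i - 1` in
`Fin ℓ`. -/
def schemeOfMatrix {K : Type*} [Field K] {r ℓ : ℕ} (H : Matrix (Fin r) (Fin (ℓ + 1)) K) :
    SecretSharingScheme (Fin r → K) K (Fin ℓ) (fun _ => K) where
  secret u := Matrix.vecMul u H 0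
  share u i := Matrix.vecMul u H i.succ

/-! ### Trace codes -/

section TraceCodes

variable (p : ℕ) [Fact p.Prime] {F : Type*} [Field F] [Algebra (ZMod p) F]

/-- The code `{(Tr(x d₁), …, Tr(x dₙ)) : x ∈ F}` over `GF(p)` of the defining set
`{d₁, …, dₙ}`. -/
noncomputable def traceCode {n : ℕ} (d : Fin n → F) : Submodule (ZMod p) (Fin n → ZMod p) :=
  LinearMap.range (LinearMap.pi fun i =>
    (Algebra.trace (ZMod p) F).comp (LinearMap.mulRight (ZMod p) (d i)))

variable (F) in
/-- The set `D` of all nonzero `x` with `Tr(x²) = 0`. -/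
def quadricSet : Set F := {x | x ≠ 0 ∧ Algebra.trace (ZMod p) F (x ^ 2) = 0}

/-- `B` is a possible choice of `D̄`: one has `D = GF(p)^* B`, and the quotient of two distinct
elements of `B` is never in `GF(p)^*`. -/
def IsReducedQuadricSet (B : Set F) : Prop :=
  quadricSet p F = {x | ∃ a : ZMod p, a ≠ 0 ∧ ∃ b ∈ B, x = algebraMap (ZMod p) F a * b} ∧
  ∀ x ∈ B, ∀ y ∈ B, x ≠ y → ∀ a : ZMod p, a ≠ 0 → x / y ≠ algebraMap (ZMod p) F a

end TraceCodes

end SecretSharing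

/-! ### The quadratic form `Tr(x²)`: isotropic vectors and their number. -/

section TraceForm

open Algebra MvPolynomial

variable {p : ℕ} [Fact p.Prime] {F : Type*} [Field F] [Algebra (ZMod p) F]

/-! Everything rests on one property of the code: if the zeros of `c` are zeros of `c'`, then `c'`
is a multiple of `c`. Since the `d i` represent all isotropic lines of `Tr(x²)`, this says that the
isotropic vectors in `x^⊥` span `x^⊥` (`exists_eq_smul_of_isotropic`). Chevalley–Warning supplies
one isotropic vector there off the line of `x`, and translating along it makes other vectors
isotropic.

Minimality of all codewords follows. By duality, access sets are the sets containing the participant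
support of some codeword with `c 0 = 1`, and by the property minimal access sets correspond
bijectively to such codewords. These are counted as fibres of one or two independent trace
functionals.

The length comes from counting the solutions of `Tr(x²) = 0`: in odd degree a nonsquare of `GF(p)`
stays nonsquare, so the quadratic character sums to zero over the trace-zero hyperplane. -/

theorem exists_trace_mul_ne_zero [Finite F] {x : F} (hx : x ≠ 0) :
    ∃ w : F, trace (ZMod p) F (x * w) ≠ 0 := by
  by_contra! h
  exact hx ((traceForm_nondegenerate (ZMod p) F).1 x fun w => by simpa [traceForm_apply] using h w)

/-- The functional `z ↦ Tr(z x)`. -/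
noncomputable def traceMul (p : ℕ) [Fact p.Prime] {F : Type*} [Field F] [Algebra (ZMod p) F]
    (x : F) : F →ₗ[ZMod p] ZMod p :=
  (trace (ZMod p) F).comp (LinearMap.mulRight (ZMod p) x)

theorem traceMul_apply (x z : F) : traceMul p x z = trace (ZMod p) F (z * x) := rfl

theorem traceMul_comm (x z : F) : traceMul p x z = traceMul p z x := by
  rw [traceMul_apply, traceMul_apply, mul_comm]

/-- A functional vanishing on the kernel of another is a multiple of it; nondegeneracy of the trace
form carries this back to `x` and `y`. -/
theorem exists_eq_smul_of_trace_mul_eq_zero [Finite F] {x y : F}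
    (h : ∀ v : F, traceMul p x v = 0 → traceMul p y v = 0) : ∃ a : ZMod p, y = a • x := by
  have hm : traceMul p y ∈ Submodule.span (ZMod p) (Set.range fun _ : Unit => traceMul p x) := by
    apply mem_span_of_iInf_ker_le_ker
    intro v hv
    simp only [Submodule.mem_iInf, LinearMap.mem_ker] at hv ⊢
    exact h v (hv ())
  rw [Set.range_const, Submodule.mem_span_singleton] at hm
  obtain ⟨a, ha⟩ := hm
  refine ⟨a, ?_⟩
  by_contra hne
  obtain ⟨w, hw⟩ := exists_trace_mul_ne_zero (p := p) (sub_ne_zero.2 hne)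
  apply hw
  have := LinearMap.congr_fun ha w
  simp only [LinearMap.smul_apply, traceMul_apply] at this
  rw [sub_mul, map_sub, smul_mul_assoc, map_smul, mul_comm y, mul_comm x, this, sub_self]

/-- A consequence of the Chevalley–Warning theorem. -/
theorem exists_isotropic_trace_eq_zero [Finite F] (hF : 5 ≤ Module.finrank (ZMod p) F) (x w : F) :
    ∃ z : F, z ≠ 0 ∧ trace (ZMod p) F (z ^ 2) = 0 ∧ traceMul p x z = 0 ∧ traceMul p w z = 0 := by
  classical
  let b := Module.finBasis (ZMod p) F
  let L (u : F) : MvPolynomial (Fin (Module.finrank (ZMod p) F)) (ZMod p) :=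
    ∑ i, C (trace (ZMod p) F (b i * u)) * X i
  let Q : MvPolynomial (Fin (Module.finrank (ZMod p) F)) (ZMod p) :=
    ∑ i, ∑ j, C (trace (ZMod p) F (b i * b j)) * (X i * X j)
  let f : Fin 3 → MvPolynomial (Fin (Module.finrank (ZMod p) F)) (ZMod p) := ![Q, L x, L w]
  have hL (u : F) : (L u).totalDegree ≤ 1 := by
    refine totalDegree_finsetSum_le fun i _ => (totalDegree_mul _ _).trans ?_
    simp
  have hQ : Q.totalDegree ≤ 2 := by
    refine totalDegree_finsetSum_le fun i _ => totalDegree_finsetSum_le fun j _ => ?_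
    refine (totalDegree_mul _ _).trans ?_
    have := totalDegree_mul (X i : MvPolynomial _ (ZMod p)) (X j)
    simp only [totalDegree_X, totalDegree_C] at this ⊢
    omega
  -- The degrees sum to at most 2 + 1 + 1 = 4, which is why dimension 5 is needed.
  have hdeg : ∑ i, (f i).totalDegree < Fintype.card (Fin (Module.finrank (ZMod p) F)) := by
    rw [Fin.sum_univ_three, Fintype.card_fin]
    have h1 : (f 0).totalDegree ≤ 2 := hQ
    have h2 : (f 1).totalDegree ≤ 1 := hL x
    have h3 : (f 2).totalDegree ≤ 1 := hL w
    omega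
  have hevL (u : F) (c) : eval c (L u) = traceMul p u (∑ i, c i • b i) := by
    simp only [L, map_sum, eval_mul, eval_C, eval_X, map_smul, traceMul_apply, smul_eq_mul]
    exact Finset.sum_congr rfl fun i _ => mul_comm _ _
  have hevQ (c) : eval c Q = trace (ZMod p) F ((∑ i, c i • b i) ^ 2) := by
    simp only [Q, map_sum, eval_mul, eval_C, eval_X, sq, Finset.sum_mul_sum, smul_mul_smul_comm,
      map_smul, smul_eq_mul]
    exact Finset.sum_congr rfl fun i _ => Finset.sum_congr rfl fun j _ => mul_comm _ _
  have h0 : ∀ i, eval (0 : Fin (Module.finrank (ZMod p) F) → ZMod p) (f i) = 0 := by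
    intro i
    fin_cases i
    · change eval _ Q = 0
      rw [hevQ]; simp
    · change eval _ (L x) = 0
      rw [hevL]; simp
    · change eval _ (L w) = 0
      rw [hevL]; simp
  -- The number of common zeros is divisible by `p` and positive, so there is a nontrivial one.
  have hpos := Fintype.card_pos_iff.2 ⟨(⟨0, h0⟩ : {c // ∀ i, eval c (f i) = 0})⟩
  have hlt := (Fact.out : p.Prime).one_lt.trans_le (Nat.le_of_dvd hpos (by
    convert char_dvd_card_solutions_of_fintype_sum_lt p hdeg))
  obtain ⟨⟨c, hc⟩, hne⟩ := Fintype.exists_ne_of_one_lt_card hlt ⟨0, h0⟩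
  refine ⟨∑ i, c i • b i, fun h => hne ?_, ?_, ?_, ?_⟩
  · exact Subtype.ext (funext fun i => Fintype.linearIndependent_iff.1 b.linearIndependent c h i)
  · rw [← hevQ]; exact hc 0
  · rw [← hevL]; exact hc 1
  · rw [← hevL]; exact hc 2

/-- The isotropic vectors orthogonal to `x` span the orthogonal complement of `x`. -/
theorem exists_eq_smul_of_isotropic [Finite F] (hp : p ≠ 2)
    (hF : 5 ≤ Module.finrank (ZMod p) F) {x y : F}
    (h : ∀ z : F, trace (ZMod p) F (z ^ 2) = 0 → traceMul p x z = 0 → traceMul p y z = 0) :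
    ∃ a : ZMod p, y = a • x := by
  have h2 : (2 : ZMod p) ≠ 0 := Ring.two_ne_zero (by rwa [ZMod.ringChar_zmod_n])
  obtain ⟨z, hz0, hz, hxz, hspan⟩ : ∃ z : F, z ≠ 0 ∧ trace (ZMod p) F (z ^ 2) = 0 ∧
      traceMul p x z = 0 ∧ ¬ ∃ a : ZMod p, z = a • x := by
    rcases eq_or_ne x 0 with rfl | hx
    · obtain ⟨z, hz0, hz, hxz, -⟩ := exists_isotropic_trace_eq_zero (p := p) hF (0 : F) 0
      exact ⟨z, hz0, hz, hxz, fun ⟨a, ha⟩ => hz0 (by rw [ha, smul_zero])⟩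
    -- Orthogonality to a `w` that is not orthogonal to `x` keeps `z` off the line of `x`.
    · obtain ⟨w, hw⟩ := exists_trace_mul_ne_zero (p := p) hx
      obtain ⟨z, hz0, hz, hxz, hwz⟩ := exists_isotropic_trace_eq_zero (p := p) hF x w
      refine ⟨z, hz0, hz, hxz, fun ⟨a, ha⟩ => hz0 ?_⟩
      rw [ha, map_smul, traceMul_apply, smul_eq_mul] at hwz
      rw [ha, (mul_eq_zero.1 hwz).resolve_right hw, zero_smul]
  have key (v : F) (hv : traceMul p x v = 0) (hzv : traceMul p z v ≠ 0) : traceMul p y v = 0 := by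
    -- As `z` is isotropic, `Tr((v - t z)²) = Tr(v²) - 2 t Tr(v z)` is linear in `t`; this is its
    -- root.
    set t : ZMod p := trace (ZMod p) F (v ^ 2) / (2 * traceMul p z v) with ht
    have hq : trace (ZMod p) F ((v - t • z) ^ 2) = 0 := by
      have : (v - t • z) ^ 2 = v ^ 2 - (2 * t) • (v * z) + (t ^ 2) • z ^ 2 := by
        simp only [Algebra.smul_def, map_mul, map_pow, map_ofNat]
        ring
      rw [this, map_add, map_sub, map_smul, map_smul, hz, ← traceMul_apply, ht]
      simp only [smul_eq_mul]
      field_simp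
      ring
    have := h _ hq (by rw [map_sub, map_smul, hv, hxz, smul_zero, sub_zero])
    rwa [map_sub, map_smul, h z hz hxz, smul_zero, sub_zero] at this
  obtain ⟨v₀, hv₀, hzv₀⟩ : ∃ v : F, traceMul p x v = 0 ∧ traceMul p z v ≠ 0 := by
    by_contra! hall
    exact hspan (exists_eq_smul_of_trace_mul_eq_zero hall)
  refine exists_eq_smul_of_trace_mul_eq_zero fun v hv => ?_
  by_cases hzv : traceMul p z v = 0
  -- Neither `v + v₀` nor `v₀` is orthogonal to `z`, so `key` applies to both.
  · have := key (v + v₀) (by rw [map_add, hv, hv₀, add_zero]) (by rwa [map_add, hzv, zero_add])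
    rwa [map_add, key v₀ hv₀ hzv₀, add_zero] at this
  · exact key v hv hzv

theorem natCard_fiber_mul {V W : Type*} [AddCommGroup V] [Module (ZMod p) V] [AddCommGroup W]
    [Module (ZMod p) W] [Finite V] (f : V →ₗ[ZMod p] W) (hf : Function.Surjective f) (w : W) :
    Nat.card {v // f v = w} * Nat.card W = Nat.card V := by
  have h1 : ∀ w', Nat.card {v // f v = w'} = Nat.card {v // f v = w} := by
    intro w'
    obtain ⟨v', rfl⟩ := hf w'
    obtain ⟨v, rfl⟩ := hf w
    refine Nat.card_congr ((Equiv.addRight (v - v')).subtypeEquiv fun u => ?_)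
    rw [Equiv.coe_addRight, map_add, map_sub, add_sub_left_comm, add_eq_left, sub_eq_zero]
  have : Finite W := Finite.of_surjective f hf
  have := Fintype.ofFinite W
  rw [Nat.card_congr (Equiv.sigmaFiberEquiv f).symm, Nat.card_sigma]
  simp [h1, Nat.card_eq_fintype_card, mul_comm]

/-- The norm of `c` is `c ^ (2k+1)`; were it a square, so would be `c`. -/
theorem not_isSquare_algebraMap_of_odd_finrank (hodd : Odd (Module.finrank (ZMod p) F))
    {c : ZMod p} (hc : ¬ IsSquare c) : ¬ IsSquare (algebraMap (ZMod p) F c) := by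
  rintro ⟨y, hy⟩
  apply hc
  have h := congrArg (Algebra.norm (ZMod p)) hy
  rw [Algebra.norm_algebraMap, map_mul] at h
  obtain ⟨k, hk⟩ := hodd
  have hc0 : c ≠ 0 := by rintro rfl; exact hc IsSquare.zero
  refine ⟨Algebra.norm (ZMod p) y / c ^ k, ?_⟩
  rw [hk, pow_succ, pow_mul'] at h
  rw [div_mul_div_comm, ← h, ← sq, mul_div_cancel_left₀]
  exact pow_ne_zero _ (pow_ne_zero _ hc0)

/-- In odd degree the equation `Tr(x²) = 0` has as many solutions as `Tr(y) = 0`. -/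
theorem natCard_trace_sq_eq_zero [Finite F] (hp : p ≠ 2)
    (hodd : Odd (Module.finrank (ZMod p) F)) :
    Nat.card {x : F // trace (ZMod p) F (x ^ 2) = 0} =
      Nat.card {y : F // trace (ZMod p) F y = 0} := by
  classical
  have := Fintype.ofFinite F
  have : CharP F p := charP_of_injective_algebraMap (algebraMap (ZMod p) F).injective p
  have hchar : ringChar F ≠ 2 := by rwa [ringChar.eq F p]
  obtain ⟨c, hc⟩ := FiniteField.exists_nonsquare (F := ZMod p) (by rwa [ZMod.ringChar_zmod_n])
  have hc0 : c ≠ 0 := by rintro rfl; exact hc IsSquare.zero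
  have hcF := not_isSquare_algebraMap_of_odd_finrank (F := F) hodd hc
  have hc0F : algebraMap (ZMod p) F c ≠ 0 := by simpa using hc0
  set S : ℤ := ∑ y : F, if trace (ZMod p) F y = 0 then quadraticChar F y else 0 with hS
  -- Multiplication by `c` permutes the trace-zero hyperplane and flips the quadratic character.
  have hneg : S = -S := by
    conv_lhs => rw [hS, ← Equiv.sum_comp (Equiv.mulLeft₀ _ hc0F)]
    rw [hS, ← Finset.sum_neg_distrib]
    refine Finset.sum_congr rfl fun y _ => ?_
    have : trace (ZMod p) F (algebraMap (ZMod p) F c * y) = c * trace (ZMod p) F y := by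
      rw [← Algebra.smul_def, map_smul, smul_eq_mul]
    simp only [Equiv.mulLeft₀_apply, this, mul_eq_zero, hc0, false_or, map_mul,
      (quadraticChar_neg_one_iff_not_isSquare).2 hcF]
    split_ifs <;> simp
  have hS0 : S = 0 := by omega
  -- Each `y` has `quadraticChar F y + 1` square roots.
  have hcount : (Nat.card {x : F // trace (ZMod p) F (x ^ 2) = 0} : ℤ) =
      ∑ y : F, if trace (ZMod p) F y = 0 then quadraticChar F y + 1 else 0 := by
    rw [Nat.card_eq_fintype_card, Fintype.card_subtype, Finset.card_filter, Nat.cast_sum,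
      ← Finset.sum_fiberwise Finset.univ (fun x : F => x ^ 2)]
    refine Finset.sum_congr rfl fun y _ => ?_
    have h1 : ∀ x ∈ Finset.univ.filter (fun x : F => x ^ 2 = y),
        (((if trace (ZMod p) F (x ^ 2) = 0 then 1 else 0 : ℕ)) : ℤ) =
          if trace (ZMod p) F y = 0 then 1 else 0 := by
      intro x hx
      rw [(Finset.mem_filter.1 hx).2]
      push_cast
      rfl
    rw [Finset.sum_congr rfl h1, Finset.sum_const, ← quadraticChar_card_sqrts hchar y]
    have h2 : {x : F | x ^ 2 = y}.toFinset = Finset.univ.filter (fun x : F => x ^ 2 = y) := by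
      ext; simp
    rw [h2]
    split_ifs <;> simp
  have hsplit : ∀ y : F, (if trace (ZMod p) F y = 0 then quadraticChar F y + 1 else 0) =
      (if trace (ZMod p) F y = 0 then quadraticChar F y else 0) +
        if trace (ZMod p) F y = 0 then 1 else 0 := by
    intro y
    split_ifs <;> simp
  rw [Finset.sum_congr rfl fun y _ => hsplit y, Finset.sum_add_distrib, ← hS, hS0,
    zero_add] at hcount
  rw [Nat.card_eq_fintype_card (α := {y : F // trace (ZMod p) F y = 0}), Fintype.card_subtype,
    Finset.card_filter]
  exact_mod_cast hcount

end TraceForm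

/-! ### Access sets and codewords of a general linear code. -/

namespace SecretSharing

section Codes

variable {K : Type*} [Field K]

/-- A functional separating `y` from `C` is a dot product with a dual codeword. -/
theorem mem_of_forall_mem_dualCode {n : ℕ} {C : Submodule K (Fin n → K)} {y : Fin n → K}
    (h : ∀ t ∈ dualCode C, y ⬝ᵥ t = 0) : y ∈ C := by
  by_contra hy
  obtain ⟨f, hfy, hf⟩ := Submodule.exists_le_ker_of_notMem hy
  have hfd (x : Fin n → K) : x ⬝ᵥ (fun i => f (Pi.single i 1)) = f x := by
    conv_rhs => rw [← Finset.univ_sum_single x, map_sum]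
    refine Finset.sum_congr rfl fun i _ => ?_
    rw [← smul_eq_mul, ← map_smul, ← Pi.single_smul, smul_eq_mul, mul_one]
  refine hfy ?_
  rw [← hfd]
  refine h _ fun x hx => ?_
  rw [hfd]
  exact hf hx

variable {r ℓ : ℕ} {H : Matrix (Fin r) (Fin (ℓ + 1)) K} {C : Submodule K (Fin (ℓ + 1) → K)}

theorem IsGeneratorMatrix.mem_iff {E : Submodule K (Fin (ℓ + 1) → K)} (hH : IsGeneratorMatrix H E)
    {t : Fin (ℓ + 1) → K} : t ∈ E ↔ ∃ u, Matrix.vecMul u H = t := by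
  rw [← hH.2, Submodule.mem_span_range_iff_exists_fun]
  simp only [Matrix.vecMul_eq_sum]
  rfl

/-- The access sets of the scheme of a dual code are described by the codewords `c` with
`c₀ = 1`. -/
theorem isAccessSet_schemeOfMatrix_iff (hH : IsGeneratorMatrix H (dualCode C))
    (A : Finset (Fin ℓ)) : (schemeOfMatrix H).IsAccessSet A ↔
      ∃ c ∈ C, c 0 = 1 ∧ ∀ i : Fin ℓ, c i.succ ≠ 0 → i ∈ A := by
  classical
  constructor
  · intro hA
    let ev (j : Fin (ℓ + 1)) : dualCode C →ₗ[K] K :=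
      (LinearMap.proj j).comp (dualCode C).subtype
    -- On the dual code, coordinate 0 vanishes wherever the coordinates in `A` do, so it is a
    -- combination of them.
    have hmem : ev 0 ∈ Submodule.span K
        (Set.range fun i : Fin ℓ => if i ∈ A then ev i.succ else 0) := by
      apply mem_span_of_iInf_ker_le_ker
      rintro ⟨t, ht⟩ hker
      simp only [Submodule.mem_iInf, LinearMap.mem_ker] at hker ⊢
      obtain ⟨u, rfl⟩ := hH.mem_iff.1 ht
      have := hA u 0 fun i hi => by
        have := hker i
        rw [if_pos hi] at this
        exact Eq.trans this (congrFun (Matrix.zero_vecMul H) _).symm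
      exact Eq.trans this (congrFun (Matrix.zero_vecMul H) _)
    obtain ⟨a, ha⟩ := (Submodule.mem_span_range_iff_exists_fun K).1 hmem
    refine ⟨Fin.cons 1 fun i => if i ∈ A then - a i else 0, ?_, rfl, fun i hi => ?_⟩
    · refine mem_of_forall_mem_dualCode fun t ht => ?_
      have h0 : t 0 = ∑ i, a i * (if i ∈ A then t i.succ else 0) := by
        have := LinearMap.congr_fun ha ⟨t, ht⟩
        rw [LinearMap.sum_apply] at this
        refine Eq.trans this.symm (Finset.sum_congr rfl fun i _ => ?_)
        rw [LinearMap.smul_apply, smul_eq_mul]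
        split_ifs <;> rfl
      rw [dotProduct, Fin.sum_univ_succ, Fin.cons_zero, one_mul, h0, ← Finset.sum_add_distrib]
      refine Finset.sum_eq_zero fun i _ => ?_
      rw [Fin.cons_succ]
      split_ifs <;> ring
    · by_contra hiA
      simp [hiA] at hi
  · rintro ⟨c, hc, hc0, hcA⟩ u v huv
    have ht : Matrix.vecMul (u - v) H ∈ dualCode C := hH.mem_iff.2 ⟨_, rfl⟩
    have h := ht c hc
    rw [dotProduct, Fin.sum_univ_succ, hc0, one_mul, Finset.sum_eq_zero, add_zero,
      Matrix.sub_vecMul, Pi.sub_apply, sub_eq_zero] at h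
    · exact h
    · intro i _
      by_cases hi : c i.succ = 0
      · rw [hi, zero_mul]
      · have := huv i (hcA i hi)
        rw [Matrix.sub_vecMul, Pi.sub_apply, sub_eq_zero.2, mul_zero]
        exact this

open Classical in
/-- The participants at which a codeword does not vanish. -/
noncomputable def participantSupport (c : Fin (ℓ + 1) → K) : Finset (Fin ℓ) :=
  Finset.univ.filter fun i => c i.succ ≠ 0

theorem mem_participantSupport {c : Fin (ℓ + 1) → K} {i : Fin ℓ} :
    i ∈ participantSupport c ↔ c i.succ ≠ 0 := by
  simp [participantSupport]

/-- Proportional codewords that agree at coordinate 0, where both are 1, are equal. -/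
theorem eq_of_participantSupport_subset
    (hC : ∀ c ∈ C, ∀ c' ∈ C, (∀ j, c j = 0 → c' j = 0) → ∃ a : K, c' = a • c)
    {c c' : Fin (ℓ + 1) → K} (hc : c ∈ C) (hc' : c' ∈ C) (h0 : c 0 = 1) (h0' : c' 0 = 1)
    (h : participantSupport c' ⊆ participantSupport c) : c' = c := by
  obtain ⟨a, rfl⟩ := hC c hc c' hc' fun j => by
    refine Fin.cases (fun hj => absurd hj (by rw [h0]; exact one_ne_zero)) (fun i hi => ?_) j
    by_contra hne
    exact mem_participantSupport.1 (h (mem_participantSupport.2 hne)) hi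
  rw [Pi.smul_apply, h0, smul_eq_mul, mul_one] at h0'
  rw [h0', one_smul]

theorem isMinimalAccessSet_iff (hH : IsGeneratorMatrix H (dualCode C))
    (hC : ∀ c ∈ C, ∀ c' ∈ C, (∀ j, c j = 0 → c' j = 0) → ∃ a : K, c' = a • c)
    (A : Finset (Fin ℓ)) : (schemeOfMatrix H).IsMinimalAccessSet A ↔
      ∃ c ∈ C, c 0 = 1 ∧ participantSupport c = A := by
  constructor
  · rintro ⟨hA, hmin⟩
    obtain ⟨c, hc, hc0, hcA⟩ := (isAccessSet_schemeOfMatrix_iff hH A).1 hA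
    refine ⟨c, hc, hc0, ?_⟩
    have hsub : participantSupport c ⊆ A := fun i hi => hcA i (mem_participantSupport.1 hi)
    by_contra hne
    exact hmin _ (hsub.ssubset_of_ne hne) ((isAccessSet_schemeOfMatrix_iff hH _).2
      ⟨c, hc, hc0, fun i => mem_participantSupport.2⟩)
  · rintro ⟨c, hc, hc0, rfl⟩
    refine ⟨(isAccessSet_schemeOfMatrix_iff hH _).2
      ⟨c, hc, hc0, fun i => mem_participantSupport.2⟩, fun B hB hacc => ?_⟩
    obtain ⟨c', hc', hc0', hcB⟩ := (isAccessSet_schemeOfMatrix_iff hH B).1 hacc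
    have hsub : participantSupport c' ⊆ B := fun i hi => hcB i (mem_participantSupport.1 hi)
    have := eq_of_participantSupport_subset hC hc hc' hc0 hc0' (hsub.trans hB.subset)
    subst this
    exact hB.not_subset hsub

theorem ncard_minimalAccessSets (hH : IsGeneratorMatrix H (dualCode C))
    (hC : ∀ c ∈ C, ∀ c' ∈ C, (∀ j, c j = 0 → c' j = 0) → ∃ a : K, c' = a • c) :
    (schemeOfMatrix H).minimalAccessSets.ncard = {c | c ∈ C ∧ c 0 = 1}.ncard := by
  have : (schemeOfMatrix H).minimalAccessSets =
      participantSupport '' {c | c ∈ C ∧ c 0 = 1} := by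
    ext A
    simp [SecretSharingScheme.minimalAccessSets, isMinimalAccessSet_iff hH hC, and_assoc]
  rw [this]
  exact Set.InjOn.ncard_image fun c hc c' hc' h =>
    (eq_of_participantSupport_subset hC hc'.1 hc.1 hc'.2 hc.2 h.le)

theorem ncard_minimalAccessSetsOf (hH : IsGeneratorMatrix H (dualCode C))
    (hC : ∀ c ∈ C, ∀ c' ∈ C, (∀ j, c j = 0 → c' j = 0) → ∃ a : K, c' = a • c) (i : Fin ℓ) :
    ((schemeOfMatrix H).minimalAccessSetsOf i).ncard =
      {c | c ∈ C ∧ c 0 = 1 ∧ c i.succ ≠ 0}.ncard := by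
  have : (schemeOfMatrix H).minimalAccessSetsOf i =
      participantSupport '' {c | c ∈ C ∧ c 0 = 1 ∧ c i.succ ≠ 0} := by
    ext A
    simp only [SecretSharingScheme.minimalAccessSetsOf, isMinimalAccessSet_iff hH hC,
      Set.mem_ofPred_eq, Set.mem_image]
    constructor
    · rintro ⟨⟨c, hc, hc0, rfl⟩, hi⟩
      exact ⟨c, ⟨hc, hc0, mem_participantSupport.1 hi⟩, rfl⟩
    · rintro ⟨c, ⟨hc, hc0, hi⟩, rfl⟩
      exact ⟨⟨c, hc, hc0, rfl⟩, mem_participantSupport.2 hi⟩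
  rw [this]
  exact Set.InjOn.ncard_image fun c hc c' hc' h =>
    (eq_of_participantSupport_subset hC hc'.1 hc.1 hc'.2.1 hc.2.1 h.le)

theorem isMinimalCodeword_of_ne_zero
    (hC : ∀ c ∈ C, ∀ c' ∈ C, (∀ j, c j = 0 → c' j = 0) → ∃ a : K, c' = a • c)
    {c : Fin (ℓ + 1) → K} (hc : c ∈ C) (h0 : c ≠ 0) : IsMinimalCodeword C c := by
  refine ⟨hc, h0, fun c' hc' h0' _ hcov => ?_⟩
  obtain ⟨a, rfl⟩ := hC c hc c' hc' fun j hj => by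
    by_contra hne
    exact hcov.subset hne hj
  have ha : a ≠ 0 := by rintro rfl; exact h0' (zero_smul _ _)
  refine hcov.not_subset fun j hj => ?_
  simpa [ha] using hj

end Codes

/-! ### The trace code of a reduced quadric set. -/

section TraceCodes

variable {p : ℕ} [Fact p.Prime] {F : Type*} [Field F] [Algebra (ZMod p) F] {n : ℕ} {d : Fin n → F}

theorem mem_traceCode_iff {c : Fin n → ZMod p} :
    c ∈ traceCode p d ↔ ∃ x : F, (fun i => traceMul p x (d i)) = c := by
  simp only [traceMul_comm (p := p) _ (d _)]
  rfl

theorem mem_quadricSet (hd : IsReducedQuadricSet p (Set.range d)) (i : Fin n) :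
    d i ∈ quadricSet p F := by
  rw [hd.1]
  exact ⟨1, one_ne_zero, d i, ⟨i, rfl⟩, by simp⟩

theorem ne_smul_of_ne (hinj : Function.Injective d) (hd : IsReducedQuadricSet p (Set.range d))
    {i j : Fin n} (hij : i ≠ j) (a : ZMod p) : d i ≠ a • d j := by
  intro h
  rcases eq_or_ne a 0 with rfl | ha
  · exact (mem_quadricSet hd i).1 (by rw [h, zero_smul])
  · refine hd.2 _ ⟨i, rfl⟩ _ ⟨j, rfl⟩ (hinj.ne hij) a ha ?_
    rw [h, Algebra.smul_def, mul_div_cancel_right₀ _ (mem_quadricSet hd j).1]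

theorem exists_eq_smul_of_traceMul_eq_zero [Finite F] (hp : p ≠ 2)
    (hF : 5 ≤ Module.finrank (ZMod p) F) (hd : IsReducedQuadricSet p (Set.range d)) {x y : F}
    (h : ∀ i, traceMul p x (d i) = 0 → traceMul p y (d i) = 0) : ∃ a : ZMod p, y = a • x := by
  refine exists_eq_smul_of_isotropic hp hF fun z hz hxz => ?_
  rcases eq_or_ne z 0 with rfl | hz0
  · exact map_zero _
  · have hmem : z ∈ quadricSet p F := ⟨hz0, hz⟩
    rw [hd.1] at hmem
    obtain ⟨a, ha, _, ⟨i, rfl⟩, rfl⟩ := hmem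
    rw [← Algebra.smul_def, map_smul] at hxz ⊢
    rw [h i ((smul_eq_zero.1 hxz).resolve_left ha), smul_zero]

theorem traceCode_exists_eq_smul [Finite F] (hp : p ≠ 2) (hF : 5 ≤ Module.finrank (ZMod p) F)
    (hd : IsReducedQuadricSet p (Set.range d)) :
    ∀ c ∈ traceCode p d, ∀ c' ∈ traceCode p d, (∀ j, c j = 0 → c' j = 0) →
      ∃ a : ZMod p, c' = a • c := by
  intro c hc c' hc' h
  obtain ⟨x, rfl⟩ := mem_traceCode_iff.1 hc
  obtain ⟨y, rfl⟩ := mem_traceCode_iff.1 hc'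
  obtain ⟨a, rfl⟩ := exists_eq_smul_of_traceMul_eq_zero hp hF hd h
  refine ⟨a, funext fun i => ?_⟩
  rw [Pi.smul_apply, traceMul_comm, map_smul, traceMul_comm]

theorem ncard_traceCode_setOf [Finite F] (hp : p ≠ 2) (hF : 5 ≤ Module.finrank (ZMod p) F)
    (hd : IsReducedQuadricSet p (Set.range d)) (P : (Fin n → ZMod p) → Prop) :
    {c | c ∈ traceCode p d ∧ P c}.ncard = {x : F | P fun i => traceMul p (d i) x}.ncard := by
  have : {c | c ∈ traceCode p d ∧ P c} =
      (fun x i => traceMul p (d i) x) '' {x : F | P fun i => traceMul p (d i) x} := by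
    ext c
    simp only [Set.mem_ofPred_eq, Set.mem_image, mem_traceCode_iff, traceMul_comm (p := p) _ (d _)]
    constructor
    · rintro ⟨⟨x, rfl⟩, h⟩
      exact ⟨x, h, rfl⟩
    · rintro ⟨x, h, rfl⟩
      exact ⟨⟨x, rfl⟩, h⟩
  rw [this]
  refine Set.ncard_image_of_injective _ fun x y hxy => ?_
  -- With `x = 0` the proportionality property says that the encoding is injective.
  obtain ⟨a, ha⟩ := exists_eq_smul_of_traceMul_eq_zero (x := 0) (y := x - y) hp hF hd fun i _ => by
    rw [traceMul_comm, map_sub, sub_eq_zero]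
    exact congrFun hxy i
  rwa [smul_zero, sub_eq_zero] at ha

theorem surjective_traceMul [Finite F] {x : F} (hx : x ≠ 0) :
    Function.Surjective (traceMul p x) := by
  refine LinearMap.surjective fun h => ?_
  obtain ⟨w, hw⟩ := exists_trace_mul_ne_zero (p := p) hx
  exact hw (by rw [mul_comm, ← traceMul_apply, h, LinearMap.zero_apply])

/-- Each functional is nonzero somewhere on the kernel of the other, which gives a dual pair up to
scaling. -/
theorem surjective_traceMul_prod [Finite F] {x y : F} (hxy : ∀ a : ZMod p, x ≠ a • y)
    (hyx : ∀ a : ZMod p, y ≠ a • x) :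
    Function.Surjective ((traceMul p x).prod (traceMul p y)) := by
  obtain ⟨v, hv, hv'⟩ : ∃ v : F, traceMul p x v = 0 ∧ traceMul p y v ≠ 0 := by
    by_contra! h
    obtain ⟨a, ha⟩ := exists_eq_smul_of_trace_mul_eq_zero h
    exact hyx a ha
  obtain ⟨w, hw, hw'⟩ : ∃ v : F, traceMul p y v = 0 ∧ traceMul p x v ≠ 0 := by
    by_contra! h
    obtain ⟨a, ha⟩ := exists_eq_smul_of_trace_mul_eq_zero h
    exact hxy a ha
  rintro ⟨α, β⟩
  refine ⟨(α / traceMul p x w) • w + (β / traceMul p y v) • v, ?_⟩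
  simp [hv, hw, hv', hw']

/-- The length of the code of a reduced quadric set. -/
theorem length_mul_eq [Finite F] (hp : p ≠ 2) (hodd : Odd (Module.finrank (ZMod p) F))
    (hinj : Function.Injective d) (hd : IsReducedQuadricSet p (Set.range d)) :
    ((p - 1) * n + 1) * p = Nat.card F := by
  -- Zero, together with `p - 1` distinct multiples of each `d i`.
  have hcard : {x : F | Algebra.trace (ZMod p) F (x ^ 2) = 0}.ncard = (p - 1) * n + 1 := by
    have h1 : {x : F | Algebra.trace (ZMod p) F (x ^ 2) = 0} = insert 0 (quadricSet p F) := by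
      ext x
      rcases eq_or_ne x 0 with rfl | hx
      · simp
      · simp [quadricSet, hx]
    have h2 : quadricSet p F =
        (fun q : (ZMod p)ˣ × Fin n => (q.1 : ZMod p) • d q.2) '' Set.univ := by
      rw [hd.1]
      ext x
      simp only [Set.mem_ofPred_eq, Set.mem_image, Set.mem_univ, true_and, Algebra.smul_def]
      constructor
      · rintro ⟨a, ha, _, ⟨i, rfl⟩, rfl⟩
        exact ⟨(Units.mk0 a ha, i), rfl⟩
      · rintro ⟨⟨a, i⟩, rfl⟩
        exact ⟨a, a.ne_zero, _, ⟨i, rfl⟩, rfl⟩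
    have h3 : Function.Injective (fun q : (ZMod p)ˣ × Fin n => (q.1 : ZMod p) • d q.2) := by
      rintro ⟨a, i⟩ ⟨b, j⟩ h
      dsimp only at h
      have hij : i = j := by
        by_contra hij
        refine ne_smul_of_ne hinj hd hij ((a : ZMod p)⁻¹ * b) ?_
        rw [mul_smul, ← h, smul_smul, inv_mul_cancel₀ a.ne_zero, one_smul]
      subst hij
      exact Prod.ext (Units.ext (smul_left_injective _ (mem_quadricSet hd i).1 h)) rfl
    rw [h1, Set.ncard_insert_of_notMem (fun h => h.1 rfl) (Set.toFinite _), h2,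
      Set.ncard_image_of_injective _ h3, Set.ncard_univ, Nat.card_prod, Nat.card_fin,
      Nat.card_eq_fintype_card, ZMod.card_units]
  have h := natCard_fiber_mul (Algebra.trace (ZMod p) F) (Algebra.trace_surjective _ _) 0
  rw [Nat.card_zmod, ← natCard_trace_sq_eq_zero hp hodd] at h
  rw [← hcard, ← h]
  rfl

end TraceCodes

end SecretSharing

/-! ### Counting for the scheme. -/

open SecretSharing

theorem mainTheorem5 (p : ℕ) [Fact p.Prime] (hp : p ≠ 2) (m : ℕ) (hm : 5 ≤ m) (hodd : Odd m)
    (F : Type*) [Field F] [Algebra (ZMod p) F] (hF : Nat.card F = p ^ m)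
    (ℓ : ℕ) (d : Fin (ℓ + 1) → F) (hinj : Function.Injective d)
    (hd : SecretSharing.IsReducedQuadricSet p (Set.range d))
    (r : ℕ) (H : Matrix (Fin r) (Fin (ℓ + 1)) (ZMod p))
    (hH : SecretSharing.IsGeneratorMatrix H
      (SecretSharing.dualCode (SecretSharing.traceCode p d))) :
    (∀ c ∈ SecretSharing.traceCode p d, c ≠ 0 →
      SecretSharing.IsMinimalCodeword (SecretSharing.traceCode p d) c) ∧
    ((SecretSharing.schemeOfMatrix H).numParticipants : ℚ) =
      ((p : ℚ) ^ (m - 1) - 1) / ((p : ℚ) - 1) - 1 ∧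
    (SecretSharing.schemeOfMatrix H).minimalAccessSets.ncard = p ^ (m - 1) ∧
    (∀ i : Fin ℓ, ((SecretSharing.schemeOfMatrix H).minimalAccessSetsOf i).ncard =
      (p - 1) * p ^ (m - 2)) ∧
    (SecretSharing.schemeOfMatrix H).IsDemocratic := by
  have hpp : p.Prime := Fact.out
  have : Finite F := Nat.finite_of_card_ne_zero (by rw [hF]; exact pow_ne_zero _ hpp.ne_zero)
  have hfin : Module.finrank (ZMod p) F = m := by
    have h := Module.natCard_eq_pow_finrank (K := ZMod p) (V := F)
    rw [hF, Nat.card_zmod] at h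
    exact (Nat.pow_right_injective hpp.two_le h).symm
  have hrank : 5 ≤ Module.finrank (ZMod p) F := hfin ▸ hm
  have hC := traceCode_exists_eq_smul hp hrank hd
  obtain ⟨k, rfl⟩ : ∃ k, m = k + 2 := ⟨m - 2, by omega⟩
  have hone : {x : F | traceMul p (d 0) x = 1}.ncard = p ^ (k + 1) := by
    have h := natCard_fiber_mul (traceMul p (d 0)) (surjective_traceMul (mem_quadricSet hd 0).1) 1
    rw [Nat.card_zmod, hF] at h
    exact Nat.eq_of_mul_eq_mul_right hpp.pos h
  have hOf (i : Fin ℓ) : ((schemeOfMatrix H).minimalAccessSetsOf i).ncard = (p - 1) * p ^ k := by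
    have hi : i.succ ≠ 0 := i.succ_ne_zero
    have h := natCard_fiber_mul ((traceMul p (d 0)).prod (traceMul p (d i.succ)))
      (surjective_traceMul_prod (ne_smul_of_ne hinj hd hi.symm) (ne_smul_of_ne hinj hd hi)) (1, 0)
    rw [Nat.card_prod, Nat.card_zmod, hF, pow_add, sq] at h
    have hzero : {x : F | traceMul p (d 0) x = 1 ∧ traceMul p (d i.succ) x = 0}.ncard = p ^ k := by
      rw [← Nat.eq_of_mul_eq_mul_right (Nat.mul_pos hpp.pos hpp.pos) h]
      exact Nat.card_congr (Equiv.subtypeEquivRight fun x => by simp)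
    -- The count is `p ^ (k + 1) - p ^ k`: remove the fibre over `(1, 0)` from the fibre over 1.
    have hdiff : {x : F | traceMul p (d 0) x = 1 ∧ traceMul p (d i.succ) x ≠ 0} =
        {x : F | traceMul p (d 0) x = 1} \
          {x : F | traceMul p (d 0) x = 1 ∧ traceMul p (d i.succ) x = 0} := by
      ext x
      simp only [Set.mem_ofPred_eq, Set.mem_sdiff]
      tauto
    rw [ncard_minimalAccessSetsOf hH hC,
      ncard_traceCode_setOf hp hrank hd fun c => c 0 = 1 ∧ c i.succ ≠ 0, hdiff,
      Set.ncard_sdiff (fun x hx => hx.1) (Set.toFinite _), hone, hzero, Nat.sub_mul, pow_succ',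
      one_mul]
  refine ⟨fun c hc h0 => isMinimalCodeword_of_ne_zero hC hc h0, ?_, ?_, hOf, fun i j => by
    rw [hOf, hOf]⟩
  · have h := length_mul_eq hp (hfin.symm ▸ hodd) hinj hd
    rw [hF, pow_succ] at h
    have h' := Nat.eq_of_mul_eq_mul_right hpp.pos h
    -- The code has length `ℓ + 1`, one more than the number of participants.
    have hq : ((p : ℚ) - 1) * (ℓ + 1) + 1 = (p : ℚ) ^ (k + 1) := by
      rw [← Nat.cast_pow, ← h']
      push_cast [Nat.cast_sub hpp.one_le]
      ring
    have hne : (p : ℚ) - 1 ≠ 0 := sub_ne_zero.2 (by exact_mod_cast hpp.one_lt.ne')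
    rw [SecretSharingScheme.numParticipants, Nat.card_fin, show k + 2 - 1 = k + 1 from rfl, ← hq]
    field_simp
    ring
  · rw [ncard_minimalAccessSets hH hC, ncard_traceCode_setOf hp hrank hd fun c => c 0 = 1]
    exact hone
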